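/- Let $R$ be an associative unital ring; "module" means unitary $R$-module (on a fixed side), and $\operatorname{card}$ denotes cardinality. For a class $\mathcal C$ of modules, a module $N$ is *$\mathcal C$-filtered* if there are an ordinal $\sigma$ and an increasing chain $(N_\alpha\mid\alpha\le\sigma)$ of submodules of $N$ such that $N_0=0$, $N_\sigma=N$, $N_\alpha=\bigcup_{\beta<\alpha}N_\beta$ for each limit ordinal $\alpha\le\sigma$, and $N_{\alpha+1}/N_\alpha$ is isomorphic to an element of $\mathcal C$ for each $\alpha<\sigma$; $\operatorname{Filt}(\mathcal C)$ is the class of all $\mathcal C$-filtered modules. A module is *$<\mu$-presented* if it is isomorphic to $F/K$ with $F$ free of rank $<\mu$ and $K$ generated by fewer than $\mu$ elements. For an infinite cardinal $\mu$, a class $\mathcal D$ of modules is *$\mu$-deconstructible* if $\mathcal D=\operatorname{Filt}(\mathcal C)$ for some set $\mathcal C\subseteq\mathcal D$ of $<\mu$-presented modules; $\mathcal D$ is *deconstructible* if it is $\mu$-deconstructible for some infinite cardinal $\mu$. For an infinite cardinal $\lambda$, $\mathcal D$ is *$\lambda$-categorical* if it contains a module of cardinality $\lambda$ and all modules of cardinality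 $\lambda$ in $\mathcal D$ are isomorphic. A module $M$ is a *strong splitter* if $\operatorname{Ext}^1_R(M,M^{(I)})=0$ for every set $I$. **Corollary.** Let $\mathcal D$ be a deconstructible class of modules containing a non-zero strong splitter $M$. Let $\nu$ be the least infinite cardinal $\ge\operatorname{card}R$ such that $\mathcal D$ is $\nu^+$-deconstructible, and let $\operatorname{Spec}(\mathcal D)$ be the class of all cardinals $\lambda\ge\nu$ such that $\mathcal D$ is $\lambda$-categorical. Let $\kappa$ be the least cardinal such that $\nu\le\kappa$ and $\operatorname{card}M\le\kappa$. Then either $\operatorname{Spec}(\mathcal D)\subseteq[\nu,\kappa)$, or there is a cardinal $\lambda\ge\kappa$ such that $$\operatorname{Spec}(\mathcal D)\cap[\kappa,\infty)=[\lambda,\infty),$$ where $[\lambda,\infty)$ denotes the class of all cardinals $\ge\lambda$. -/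

import Mathlib

universe u

open CategoryTheory Cardinal

namespace ModuleClass

variable {R : Type u} [Ring R]

/-- `M` is `C`-filtered (a transfinite extension of modules from `C`): there are an ordinal `σ`
and a continuous increasing chain of submodules `F α` (`α ≤ σ`) of `M` with `F 0 = 0`, `F σ = M`,
and every factor `F (α + 1) / F α` (`α < σ`) isomorphic to a member of `C`. -/
def IsFiltered (C : ObjectProperty (ModuleCat.{u} R)) (M : ModuleCat.{u} R) : Prop :=
  ∃ (σ : Ordinal.{u}) (F : Ordinal.{u} → Submodule R M),
    MonotoneOn F (Set.Iic σ) ∧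
    F 0 = ⊥ ∧
    F σ = ⊤ ∧
    (∀ α ≤ σ, Order.IsSuccLimit α → F α = ⨆ β : Set.Iio α, F β) ∧
    ∀ α < σ, ∃ X : ModuleCat.{u} R, C X ∧
      Nonempty ((F (Order.succ α) ⧸ (F α).submoduleOf (F (Order.succ α))) ≃ₗ[R] X)

/-- `Filt C`, the class of all `C`-filtered modules. -/
def Filt (C : ObjectProperty (ModuleCat.{u} R)) : ObjectProperty (ModuleCat.{u} R) :=
  fun M => IsFiltered C M

/-- `M` is `< κ`-presented: there is a short exact sequence `0 → K → R^(X) → M → 0` where `X` has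
fewer than `κ` elements and `K` is generated by fewer than `κ` elements. -/
def IsLTPresented (κ : Cardinal.{u}) (M : ModuleCat.{u} R) : Prop :=
  ∃ (X : Type u) (f : (X →₀ R) →ₗ[R] M) (S : Set (X →₀ R)),
    #X < κ ∧ Function.Surjective f ∧ #S < κ ∧ Submodule.span R S = LinearMap.ker f

/-- `D` is `κ`-deconstructible: `κ` is infinite and `D = Filt C` for some set (that is, a small
class) `C ⊆ D` of `< κ`-presented modules. -/
def IsDeconstructibleAt (κ : Cardinal.{u}) (D : ObjectProperty (ModuleCat.{u} R)) : Prop :=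
  ℵ₀ ≤ κ ∧ ∃ C : ObjectProperty (ModuleCat.{u} R),
    ObjectProperty.Small.{u} C ∧ C ≤ D ∧ (∀ X, C X → IsLTPresented κ X) ∧ D = Filt C

/-- `D` is deconstructible: it is `κ`-deconstructible for some infinite cardinal `κ`. -/
def IsDeconstructible (D : ObjectProperty (ModuleCat.{u} R)) : Prop :=
  ∃ κ : Cardinal.{u}, IsDeconstructibleAt κ D

/-- The infinite cardinals `c ≥ card R` such that `D` is `c⁺`-deconstructible. -/
def deconstructionCardinals (D : ObjectProperty (ModuleCat.{u} R)) : Set Cardinal.{u} :=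
  {c | ℵ₀ ≤ c ∧ #R ≤ c ∧ IsDeconstructibleAt (Order.succ c) D}

/-- The least infinite cardinal `c ≥ card R` such that `D` is `c⁺`-deconstructible; it exists for
every deconstructible `D`, see `isLeast_deconstructionCardinal`. -/
noncomputable def deconstructionCardinal (D : ObjectProperty (ModuleCat.{u} R)) : Cardinal.{u} :=
  sInf (deconstructionCardinals D)

theorem IsDeconstructibleAt.mono {κ μ : Cardinal.{u}} (h : κ ≤ μ)
    {D : ObjectProperty (ModuleCat.{u} R)} (hD : IsDeconstructibleAt κ D) :
    IsDeconstructibleAt μ D := by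
  obtain ⟨hκ, C, hs, hC, hp, he⟩ := hD
  refine ⟨hκ.trans h, C, hs, hC, fun X hX => ?_, he⟩
  obtain ⟨Y, f, S, h1, h2, h3, h4⟩ := hp X hX
  exact ⟨Y, f, S, h1.trans_le h, h2, h3.trans_le h, h4⟩

theorem isLeast_deconstructionCardinal {D : ObjectProperty (ModuleCat.{u} R)}
    (hD : IsDeconstructible D) :
    IsLeast (deconstructionCardinals D) (deconstructionCardinal D) := by
  obtain ⟨κ, hκ⟩ := hD
  refine ⟨csInf_mem ⟨max κ #R, ?_, le_max_right _ _, ?_⟩, fun c hc => csInf_le' hc⟩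
  · exact hκ.1.trans (le_max_left _ _)
  · exact hκ.mono ((le_max_left _ _).trans (Order.le_succ _))

/-- `D` is `c`-categorical, for an infinite cardinal `c`: it contains a module of cardinality `c`,
and any two modules of cardinality `c` in `D` are isomorphic. -/
def IsCategorical (c : Cardinal.{u}) (D : ObjectProperty (ModuleCat.{u} R)) : Prop :=
  ℵ₀ ≤ c ∧ (∃ M : ModuleCat.{u} R, D M ∧ #M = c) ∧
    ∀ M N : ModuleCat.{u} R, D M → D N → #M = c → #N = c → Nonempty (M ≃ₗ[R] N)

/-- The categoricity spectrum of a deconstructible class `D`. -/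
def categoricitySpectrum (D : ObjectProperty (ModuleCat.{u} R)) : Set Cardinal.{u} :=
  {c | deconstructionCardinal D ≤ c ∧ IsCategorical c D}

/-- `M` is a strong splitter: `Ext¹(M, M^(I)) = 0` for every set `I`. -/
def IsStrongSplitter (M : ModuleCat.{u} R) : Prop :=
  ∀ I : Type u, Subsingleton (Abelian.Ext M (ModuleCat.of R (I →₀ M)) 1)

end ModuleClass

namespace ModuleClass

variable {R : Type u} [Ring R]

/-! The core is that categoricity passes upward from any cardinal c ≥ κ (`IsCategorical.mono`); λ is
then the least element of the spectrum in [κ, ∞), if there is one.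

Write D = Filt(C), where all members of C have cardinality at most ν ≤ c. Since D contains M^(c),
categoricity at c makes every module of cardinality c in D isomorphic to M^(c). It suffices to show
that each N in D with card N > c is a direct sum of copies of M, since card N then determines the
number of copies.

By Zorn, choose a maximal submodule A = M^(Φ) of N, with its decomposition, that is a segment of a
filtration of N. If card(N/A) ≥ c, some segment B ⊇ A has card(B/A) = c, because the factors are
small. Then B/A ≅ M^(c), and the extension splits because M is a strong splitter, so B enlarges the
decomposition, a contradiction. Hence card(N/A) < c (`exists_famIndep_mk_quotient_lt`).

The small quotient is absorbed as follows (`exists_equiv_finsupp_of_famIndep`). Choose H with H + A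
= N and H ∩ A = M^(J), where J ⊆ Φ and J and H have cardinality c. Then H is an extension of N/A by
M^(J), so H lies in D and H ≅ M^(c). Finally N = H ⊕ M^(Φ \ J). -/

theorem le_iSup_subtype {ι L : Type*} [CompleteLattice L] (F : ι → L) {p : ι → Prop} {i : ι}
    (h : p i) : F i ≤ ⨆ j : {j // p j}, F j.1 :=
  le_iSup (fun j : {j // p j} => F j.1) ⟨i, h⟩

theorem iSup_subtype_le {ι L : Type*} [CompleteLattice L] (F : ι → L) (p : ι → Prop) :
    (⨆ j : {j // p j}, F j.1) ≤ ⨆ j, F j :=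
  iSup_le fun j => le_iSup F j.1

theorem iSup_subtype_mono {ι L : Type*} [CompleteLattice L] (F : ι → L) {p q : ι → Prop}
    (h : ∀ j, p j → q j) : (⨆ j : {j // p j}, F j.1) ≤ ⨆ j : {j // q j}, F j.1 :=
  iSup_le fun j => le_iSup_subtype F (h _ j.2)

/-! ### Filtrations of subquotients indexed by well-ordered sets -/

section Filtered

variable {N Q : Type u} [AddCommGroup N] [Module R N] [AddCommGroup Q] [Module R Q]
  {C : ObjectProperty (ModuleCat.{u} R)}

theorem mem_submoduleOf_iff {A B : Submodule R N} {b : B} :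
    b ∈ A.submoduleOf B ↔ (b : N) ∈ A := Iff.rfl

/-- The quotient `B / A` is isomorphic to a member of `C`. -/
def IsFactor (C : ObjectProperty (ModuleCat.{u} R)) (A B : Submodule R N) : Prop :=
  ∃ X : ModuleCat.{u} R, C X ∧ ∃ f : B →ₗ[R] X, Function.Surjective f ∧
    LinearMap.ker f = A.submoduleOf B

theorem isFactor_iff {A B : Submodule R N} :
    IsFactor C A B ↔ ∃ X : ModuleCat.{u} R, C X ∧ Nonempty ((B ⧸ A.submoduleOf B) ≃ₗ[R] X) := by
  refine exists_congr fun X => and_congr_right fun _ => ⟨?_, ?_⟩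
  · rintro ⟨f, hf, hk⟩
    exact ⟨(Submodule.quotEquivOfEq _ _ hk.symm).trans (f.quotKerEquivOfSurjective hf)⟩
  · rintro ⟨e⟩
    refine ⟨e.toLinearMap ∘ₗ (A.submoduleOf B).mkQ,
      e.surjective.comp (Submodule.mkQ_surjective _), ?_⟩
    rw [LinearMap.ker_comp, LinearEquiv.ker, Submodule.comap_bot, Submodule.ker_mkQ]

/-- `B / A` is `C`-filtered, witnessed by a well-ordered family of submodules which, added to `A`
one after the other, exhaust `B`. -/
def Filtered (C : ObjectProperty (ModuleCat.{u} R)) (A B : Submodule R N) : Prop :=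
  ∃ (ι : Type u) (_ : LinearOrder ι) (_ : WellFoundedLT ι) (F : ι → Submodule R N),
    (∀ i, IsFactor C (A ⊔ ⨆ j : {j // j < i}, F j.1) (A ⊔ ⨆ j : {j // j ≤ i}, F j.1)) ∧
    A ⊔ ⨆ i, F i = B

/-- The image in `Q` of a submodule of `N` under a linear map defined on `B`. -/
def push (B : Submodule R N) (f : B →ₗ[R] Q) (X : Submodule R N) : Submodule R Q :=
  (X.comap B.subtype).map f

/-- The preimage in `N` of a submodule of `Q` under a linear map defined on `B`. -/
def pull (B : Submodule R N) (f : B →ₗ[R] Q) (Y : Submodule R Q) : Submodule R N :=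
  (Y.comap f).map B.subtype

theorem mem_pull {B : Submodule R N} {f : B →ₗ[R] Q} {Y : Submodule R Q} {x : N} :
    x ∈ pull B f Y ↔ ∃ h : x ∈ B, f ⟨x, h⟩ ∈ Y := by
  simp [pull]

theorem mem_push {B : Submodule R N} {f : B →ₗ[R] Q} {X : Submodule R N} {y : Q} :
    y ∈ push B f X ↔ ∃ b : B, (b : N) ∈ X ∧ f b = y := by
  simp [push]

theorem push_self {A B : Submodule R N} {f : B →ₗ[R] Q}
    (hk : LinearMap.ker f = A.submoduleOf B) : push B f A = ⊥ := by
  rw [push, ← Submodule.submoduleOf, ← hk, eq_bot_iff, Submodule.map_le_iff_le_comap]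
  exact le_rfl

/-- The summand `A` is the pullback of zero; it is needed when `ι` is empty. -/
theorem pull_sup_iSup {ι : Sort*} {A B : Submodule R N} (hAB : A ≤ B) {f : B →ₗ[R] Q}
    (hf : Function.Surjective f) (hk : LinearMap.ker f = A.submoduleOf B)
    (Y : ι → Submodule R Q) : pull B f (⨆ i, Y i) = A ⊔ ⨆ i, pull B f (Y i) := by
  have h1 : (⨆ i, Y i).comap f = (⨆ i, (Y i).comap f) ⊔ LinearMap.ker f := by
    rw [← Submodule.comap_map_eq, Submodule.map_iSup]
    simp only [Submodule.map_comap_eq_of_surjective hf]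
  rw [pull, h1, Submodule.map_sup, Submodule.map_iSup, hk, Submodule.submoduleOf,
    Submodule.map_comap_subtype, inf_eq_right.2 hAB, sup_comm]
  rfl

/-- Intersecting with `B` commutes with sums only for submodules inside `B`, whence `hX`. -/
theorem push_sup_iSup {ι : Sort*} {A B : Submodule R N} (hAB : A ≤ B) {f : B →ₗ[R] Q}
    (hk : LinearMap.ker f = A.submoduleOf B)
    (X : ι → Submodule R N) (hX : ∀ i, X i ≤ B) :
    push B f (A ⊔ ⨆ i, X i) = ⨆ i, push B f (X i) := by
  have h : ∀ Y ≤ B, (Y.comap B.subtype).map B.subtype = Y := fun Y hY => by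
    rw [Submodule.map_comap_subtype, inf_eq_right.2 hY]
  have h1 : A ⊔ ⨆ i, X i =
      (A.comap B.subtype ⊔ ⨆ i, (X i).comap B.subtype).map B.subtype := by
    rw [Submodule.map_sup, Submodule.map_iSup, h A hAB]
    simp only [h _ (hX _)]
  rw [push, h1, Submodule.comap_map_eq_of_injective B.injective_subtype, Submodule.map_sup,
    Submodule.map_iSup]
  change push B f A ⊔ _ = _
  rw [push_self hk, bot_sup_eq]
  rfl

theorem IsFactor.pull {B : Submodule R N} {f : B →ₗ[R] Q} (hf : Function.Surjective f)
    {Y₁ Y₂ : Submodule R Q} (h : IsFactor C Y₁ Y₂) :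
    IsFactor C (pull B f Y₁) (pull B f Y₂) := by
  obtain ⟨X, hX, g, hg, hk⟩ := h
  have hk' : ∀ b : Y₂, g b = 0 ↔ (b : Q) ∈ Y₁ := fun b => by
    rw [← LinearMap.mem_ker, hk, mem_submoduleOf_iff]
  have hB : ∀ x : ModuleClass.pull B f Y₂, (x : N) ∈ B := fun x => (mem_pull.1 x.2).1
  let φ : ModuleClass.pull B f Y₂ →ₗ[R] Y₂ :=
    (f ∘ₗ Submodule.inclusion (fun x hx => hB ⟨x, hx⟩)).codRestrict Y₂
      (fun x => (mem_pull.1 x.2).2)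
  refine ⟨X, hX, g ∘ₗ φ, hg.comp ?_, ?_⟩
  · rintro ⟨y, hy⟩
    obtain ⟨b, rfl⟩ := hf y
    exact ⟨⟨b, mem_pull.2 ⟨b.2, hy⟩⟩, rfl⟩
  · ext x
    rw [LinearMap.mem_ker, LinearMap.comp_apply, hk', mem_submoduleOf_iff, mem_pull]
    exact ⟨fun h => ⟨hB x, h⟩, fun h => h.2⟩

theorem IsFactor.push {A B : Submodule R N} {f : B →ₗ[R] Q}
    (hk : LinearMap.ker f = A.submoduleOf B) {X₁ X₂ : Submodule R N} (h1 : A ≤ X₁)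
    (h2 : X₂ ≤ B) (h : IsFactor C X₁ X₂) :
    IsFactor C (push B f X₁) (push B f X₂) := by
  obtain ⟨X, hX, ⟨e⟩⟩ := isFactor_iff.1 h
  have hk' : ∀ b : B, f b = 0 ↔ (b : N) ∈ A := fun b => by
    rw [← LinearMap.mem_ker, hk, mem_submoduleOf_iff]
  let φ : X₂ →ₗ[R] ModuleClass.push B f X₂ :=
    (f ∘ₗ Submodule.inclusion h2).codRestrict _ (fun x => mem_push.2 ⟨⟨x, h2 x.2⟩, x.2, rfl⟩)
  have hφ : Function.Surjective φ := by
    rintro ⟨y, hy⟩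
    obtain ⟨b, hb, rfl⟩ := mem_push.1 hy
    exact ⟨⟨b, hb⟩, rfl⟩
  let ψ : X₂ →ₗ[R] (ModuleClass.push B f X₂ ⧸ (ModuleClass.push B f X₁).submoduleOf
      (ModuleClass.push B f X₂)) := Submodule.mkQ _ ∘ₗ φ
  have hψ : Function.Surjective ψ := (Submodule.mkQ_surjective _).comp hφ
  have hψk : LinearMap.ker ψ = X₁.submoduleOf X₂ := by
    ext x
    rw [LinearMap.ker_comp, Submodule.ker_mkQ, Submodule.mem_comap, mem_submoduleOf_iff,
      mem_submoduleOf_iff, mem_push]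
    constructor
    · rintro ⟨b, hb, hbx⟩
      have : f (b - ⟨x, h2 x.2⟩) = 0 := by
        rw [map_sub, hbx]
        exact sub_self _
      have h3 := sub_mem hb (h1 ((hk' _).1 this))
      simpa using h3
    · exact fun hx => ⟨⟨x, h2 x.2⟩, hx, rfl⟩
  exact isFactor_iff.2 ⟨X, hX, ⟨(((Submodule.quotEquivOfEq _ _ hψk.symm).trans
    (ψ.quotKerEquivOfSurjective hψ)).symm).trans e⟩⟩

theorem Filtered.pull {A B : Submodule R N} (hAB : A ≤ B) {f : B →ₗ[R] Q}
    (hf : Function.Surjective f) (hk : LinearMap.ker f = A.submoduleOf B)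
    (h : Filtered C (⊥ : Submodule R Q) ⊤) : Filtered C A B := by
  obtain ⟨ι, _, _, F, hF, htop⟩ := h
  refine ⟨ι, _, ‹_›, fun i => ModuleClass.pull B f (F i), fun i => ?_, ?_⟩
  · rw [← pull_sup_iSup hAB hf hk, ← pull_sup_iSup hAB hf hk]
    simpa using (hF i).pull hf
  · rw [← pull_sup_iSup hAB hf hk]
    rw [bot_sup_eq] at htop
    rw [htop]
    simp [ModuleClass.pull]

theorem Filtered.push {A B : Submodule R N} {f : B →ₗ[R] Q}
    (hf : Function.Surjective f) (hk : LinearMap.ker f = A.submoduleOf B)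
    (h : Filtered C A B) : Filtered C (⊥ : Submodule R Q) ⊤ := by
  obtain ⟨ι, _, _, F, hF, rfl⟩ := h
  have hAB : A ≤ A ⊔ ⨆ i, F i := le_sup_left
  have hFB : ∀ i, F i ≤ A ⊔ ⨆ i, F i := fun i => (le_iSup F i).trans le_sup_right
  refine ⟨ι, _, ‹_›, fun i => ModuleClass.push _ f (F i), fun i => ?_, ?_⟩
  · rw [bot_sup_eq, bot_sup_eq,
      ← push_sup_iSup hAB hk (fun j : {j // j < i} => F j.1) fun _ => hFB _,
      ← push_sup_iSup hAB hk (fun j : {j // j ≤ i} => F j.1) fun _ => hFB _]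
    exact (hF i).push hk le_sup_left (sup_le le_sup_left (iSup_le fun j => hFB _))
  · rw [bot_sup_eq, ← push_sup_iSup hAB hk F hFB, ModuleClass.push, Submodule.comap_subtype_self,
      Submodule.map_top, LinearMap.range_eq_top.2 hf]

/-- The step at an ordinal i < σ contributes `F (succ i)`. By continuity at limits, the sum of the
contributions before i is exactly `F i`. -/
theorem IsFiltered.filtered {M : ModuleCat.{u} R} (h : IsFiltered C M) :
    Filtered C (⊥ : Submodule R M) ⊤ := by
  obtain ⟨σ, F, hmono, h0, hσ, hlim, hsucc⟩ := h
  have hu : ∀ α ≤ σ, F α ≤ ⨆ β : {β : σ.ToType // (Ordinal.ToType.toOrd β : Ordinal) < α},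
      F (Order.succ (Ordinal.ToType.toOrd β.1 : Ordinal)) := by
    intro α hα
    rcases Ordinal.zero_or_succ_or_isSuccLimit α with rfl | ⟨β, rfl⟩ | h
    · rw [h0]
      exact bot_le
    · refine le_iSup_of_le ⟨Ordinal.ToType.mk ⟨β, Order.succ_le_iff.1 hα⟩, ?_⟩ ?_ <;> simp
    · rw [hlim α hα h]
      refine iSup_le fun β => ?_
      refine le_iSup_of_le ⟨Ordinal.ToType.mk ⟨β, lt_of_lt_of_le β.2 hα⟩, ?_⟩ ?_
      · simpa using Set.mem_Iio.1 β.2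
      · have hβ : Order.succ (β : Ordinal) ≤ σ := Order.succ_le_of_lt (lt_of_lt_of_le β.2 hα)
        simpa using hmono ((Order.le_succ _).trans hβ) hβ (Order.le_succ (β : Ordinal))
  have hs : ∀ β : σ.ToType, Order.succ (Ordinal.ToType.toOrd β : Ordinal) ≤ σ := fun β =>
    Order.succ_le_of_lt (Ordinal.ToType.toOrd β).2
  refine ⟨σ.ToType, inferInstance, inferInstance,
    fun i => F (Order.succ (Ordinal.ToType.toOrd i : Ordinal)), fun i => ?_, ?_⟩
  · obtain ⟨X, hX, e⟩ := hsucc _ (Set.mem_Iio.1 (Ordinal.ToType.toOrd i).2)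
    have h1 : (⊥ ⊔ ⨆ j : {j // j < i}, F (Order.succ (Ordinal.ToType.toOrd j.1 : Ordinal))) =
        F (Ordinal.ToType.toOrd i : Ordinal) := by
      rw [bot_sup_eq]
      refine le_antisymm (iSup_le fun j => hmono (hs _)
        (Set.mem_Iio.1 (Ordinal.ToType.toOrd i).2).le ?_)
        ((hu _ (Ordinal.ToType.toOrd i).2.le).trans (iSup_le fun j => ?_))
      · exact Order.succ_le_of_lt (Ordinal.ToType.mk.symm.lt_iff_lt.2 j.2)
      · exact le_iSup (fun j : {j // j < i} => F (Order.succ (Ordinal.ToType.toOrd j.1 : Ordinal)))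
          ⟨j.1, Ordinal.ToType.mk.symm.lt_iff_lt.1 j.2⟩
    have h2 : (⊥ ⊔ ⨆ j : {j // j ≤ i}, F (Order.succ (Ordinal.ToType.toOrd j.1 : Ordinal))) =
        F (Order.succ (Ordinal.ToType.toOrd i : Ordinal)) := by
      rw [bot_sup_eq]
      refine le_antisymm (iSup_le fun j => hmono (hs _) (hs _) ?_) (le_iSup (fun j : {j // j ≤ i} =>
        F (Order.succ (Ordinal.ToType.toOrd j.1 : Ordinal))) ⟨i, le_rfl⟩)
      exact Order.succ_le_succ (Ordinal.ToType.mk.symm.le_iff_le.2 j.2)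
    rw [h1, h2]
    exact isFactor_iff.2 ⟨X, hX, e⟩
  · rw [bot_sup_eq, eq_top_iff, ← hσ]
    exact (hu σ le_rfl).trans (iSup_le fun j =>
      le_iSup (fun j => F (Order.succ (Ordinal.ToType.toOrd j : Ordinal))) j.1)

/-- The chain sends α to the sum of the members of position below α in the well-order, which is
continuous by construction. -/
theorem Filtered.isFiltered {M : ModuleCat.{u} R} (h : Filtered C (⊥ : Submodule R M) ⊤) :
    IsFiltered C M := by
  obtain ⟨ι, _, _, F, hF, htop⟩ := h
  rw [bot_sup_eq] at htop
  have hwo : IsWellOrder ι (· < ·) := inferInstance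
  let t : ι → Ordinal.{u} := Ordinal.typein (α := ι) (· < ·)
  have ht : ∀ {i j}, t i < t j ↔ i < j := Ordinal.typein_lt_typein (α := ι) (· < ·)
  have ht' : ∀ {i j}, t i ≤ t j ↔ i ≤ j := fun {i j} => by
    rw [← not_lt, ht, not_lt]
  refine ⟨Ordinal.type (α := ι) (· < ·), fun α => ⨆ j : {j : ι // t j < α}, F j.1,
    ?_, ?_, ?_, ?_, ?_⟩
  · exact fun α _ β _ hαβ => iSup_subtype_mono F fun j hj => hj.trans_le hαβ
  · exact eq_bot_iff.2 (iSup_le fun j => absurd j.2 (not_lt.2 bot_le))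
  · rw [eq_top_iff, ← htop]
    exact iSup_le fun j => le_iSup_subtype F (Ordinal.typein_lt_type _ j)
  · intro α _ hlim
    refine le_antisymm (iSup_le fun j => ?_)
      (iSup_le fun β => iSup_subtype_mono F fun j hj => hj.trans β.2)
    refine le_iSup_of_le ⟨Order.succ (t j.1), hlim.succ_lt j.2⟩ ?_
    exact le_iSup_subtype F (p := fun i => t i < Order.succ (t j.1)) (Order.lt_succ _)
  · intro α hα
    obtain ⟨i, hi⟩ : ∃ i, t i = α := Ordinal.typein_surj (α := ι) _ hα
    subst hi
    have h := hF i
    rw [bot_sup_eq, bot_sup_eq] at h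
    have h1 : (⨆ j : {j : ι // t j < t i}, F j.1) = ⨆ j : {j // j < i}, F j.1 :=
      le_antisymm (iSup_subtype_mono F fun j => ht.1) (iSup_subtype_mono F fun j => ht.2)
    have h2 : (⨆ j : {j : ι // t j < Order.succ (t i)}, F j.1) = ⨆ j : {j // j ≤ i}, F j.1 :=
      le_antisymm (iSup_subtype_mono F fun j hj => ht'.1 (Order.lt_succ_iff.1 hj))
        (iSup_subtype_mono F fun j hj => Order.lt_succ_iff.2 (ht'.2 hj))
    beta_reduce
    rw [h1, h2]
    exact isFactor_iff.1 h

/-- This translates between membership of a module in the class and filtrations of any subquotient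
isomorphic to it, so that all later gluing happens inside one ambient module. -/
theorem filt_iff_filtered {A B : Submodule R N} (hAB : A ≤ B) {M : ModuleCat.{u} R}
    {f : B →ₗ[R] M} (hf : Function.Surjective f) (hk : LinearMap.ker f = A.submoduleOf B) :
    Filt C M ↔ Filtered C A B :=
  ⟨fun h => Filtered.pull hAB hf hk (IsFiltered.filtered h),
    fun h => Filtered.isFiltered (Filtered.push hf hk h)⟩

theorem iSup_sigma_lex_lt {ι : Type*} {κ : ι → Type*} {L : Type*} [CompleteLattice L]
    [LinearOrder ι] [∀ i, LinearOrder (κ i)] (G : ∀ i, κ i → L) (i : ι) (k : κ i) :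
    (⨆ j : {j : Σₗ i, κ i // j < toLex ⟨i, k⟩}, G (ofLex j.1).1 (ofLex j.1).2) =
      (⨆ j : {j // j < i}, ⨆ l, G j.1 l) ⊔ ⨆ l : {l // l < k}, G i l.1 := by
  apply le_antisymm
  · refine iSup_le ?_
    rintro ⟨⟨j, l⟩, h⟩
    rcases h with ⟨_, _, h⟩ | ⟨_, _, h⟩
    · exact le_sup_of_le_left (le_iSup_of_le ⟨j, h⟩ (le_iSup (G j) l))
    · exact le_sup_of_le_right (le_iSup (fun l : {l // l < k} => G _ l.1) ⟨l, h⟩)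
  · refine sup_le (iSup_le fun j => iSup_le fun l => ?_) (iSup_le fun l => ?_)
    · exact le_iSup (fun j : {j : Σₗ i, κ i // j < toLex ⟨i, k⟩} => G (ofLex j.1).1 (ofLex j.1).2)
        ⟨toLex ⟨j.1, l⟩, Sigma.Lex.lt_def.2 (Or.inl j.2)⟩
    · exact le_iSup (fun j : {j : Σₗ i, κ i // j < toLex ⟨i, k⟩} => G (ofLex j.1).1 (ofLex j.1).2)
        ⟨toLex ⟨i, l.1⟩, Sigma.Lex.lt_def.2 (Or.inr ⟨rfl, l.2⟩)⟩

theorem iSup_sigma_lex_le {ι : Type*} {κ : ι → Type*} {L : Type*} [CompleteLattice L]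
    [LinearOrder ι] [∀ i, LinearOrder (κ i)] (G : ∀ i, κ i → L) (i : ι) (k : κ i) :
    (⨆ j : {j : Σₗ i, κ i // j ≤ toLex ⟨i, k⟩}, G (ofLex j.1).1 (ofLex j.1).2) =
      (⨆ j : {j // j < i}, ⨆ l, G j.1 l) ⊔ ⨆ l : {l // l ≤ k}, G i l.1 := by
  apply le_antisymm
  · refine iSup_le ?_
    rintro ⟨⟨j, l⟩, h⟩
    rcases h with ⟨_, _, h⟩ | ⟨_, _, h⟩
    · exact le_sup_of_le_left (le_iSup_of_le ⟨j, h⟩ (le_iSup (G j) l))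
    · exact le_sup_of_le_right (le_iSup (fun l : {l // l ≤ k} => G _ l.1) ⟨l, h⟩)
  · refine sup_le (iSup_le fun j => iSup_le fun l => ?_) (iSup_le fun l => ?_)
    · exact le_iSup (fun j : {j : Σₗ i, κ i // j ≤ toLex ⟨i, k⟩} => G (ofLex j.1).1 (ofLex j.1).2)
        ⟨toLex ⟨j.1, l⟩, Sigma.Lex.le_def.2 (Or.inl j.2)⟩
    · exact le_iSup (fun j : {j : Σₗ i, κ i // j ≤ toLex ⟨i, k⟩} => G (ofLex j.1).1 (ofLex j.1).2)
        ⟨toLex ⟨i, l.1⟩, Sigma.Lex.le_def.2 (Or.inr ⟨rfl, l.2⟩)⟩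

theorem iSup_sigma_lex {ι : Type*} {κ : ι → Type*} {L : Type*} [CompleteLattice L]
    (G : ∀ i, κ i → L) :
    (⨆ j : Σₗ i, κ i, G (ofLex j).1 (ofLex j).2) = ⨆ i, ⨆ k, G i k :=
  iSup_sigma' G |>.symm

theorem wellFoundedLT_sigma_lex {ι : Type*} {κ : ι → Type*} [LinearOrder ι] [WellFoundedLT ι]
    [∀ i, LinearOrder (κ i)] [∀ i, WellFoundedLT (κ i)] : WellFoundedLT (Σₗ i, κ i) := by
  refine ⟨⟨?_⟩⟩
  rintro ⟨i, k⟩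
  induction i using WellFoundedLT.induction with
  | ind i ihi =>
    induction k using WellFoundedLT.induction with
    | ind k ihk =>
      refine ⟨_, ?_⟩
      rintro ⟨j, l⟩ h
      rcases h with ⟨_, _, h⟩ | ⟨_, _, h⟩
      · exact ihi j h l
      · exact ihk l h

/-- A transfinite extension of transfinite extensions of members of `C` is `C`-filtered. -/
theorem filtered_iSup {ι : Type u} [LinearOrder ι] [WellFoundedLT ι] {A : Submodule R N}
    {F : ι → Submodule R N}
    (h : ∀ i, Filtered C (A ⊔ ⨆ j : {j // j < i}, F j.1) (A ⊔ ⨆ j : {j // j ≤ i}, F j.1)) :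
    Filtered C A (A ⊔ ⨆ i, F i) := by
  choose κ _ _ G hG hGt using h
  -- `S j` collects the submodules refining the `j`-th step. Together with `A`, the families `S` and
  -- `F` have the same initial sums, so the refinements concatenate along the lexicographic order.
  obtain ⟨S, hS⟩ : ∃ S : ι → Submodule R N, ∀ j, S j = ⨆ k, G j k := ⟨_, fun _ => rfl⟩
  have hSle : ∀ i, S i ≤ A ⊔ ⨆ j : {j // j ≤ i}, F j.1 := fun i => by
    rw [← hGt i, hS]
    exact le_sup_right
  have hle : ∀ i, F i ≤ A ⊔ ⨆ j : {j // j ≤ i}, S j.1 := by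
    intro i
    induction i using WellFoundedLT.induction with
    | ind i ih =>
      have hi : F i ≤ A ⊔ ⨆ j : {j // j ≤ i}, F j.1 :=
        le_sup_of_le_right (le_iSup_subtype F le_rfl)
      refine hi.trans ?_
      rw [← hGt i]
      refine sup_le (sup_le le_sup_left (iSup_le fun j => (ih j.1 j.2).trans ?_)) ?_
      · exact sup_le_sup_left (iSup_subtype_mono S fun l hl => hl.trans j.2.le) _
      · rw [← hS]
        exact le_sup_of_le_right (le_iSup_subtype S (p := (· ≤ i)) le_rfl)
  have hW : ∀ i, A ⊔ (⨆ j : {j // j < i}, S j.1) = A ⊔ ⨆ j : {j // j < i}, F j.1 := by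
    intro i
    refine le_antisymm (sup_le le_sup_left (iSup_le fun j => (hSle _).trans ?_))
      (sup_le le_sup_left (iSup_le fun j => (hle _).trans ?_))
    · exact sup_le_sup_left (iSup_subtype_mono F fun l hl => hl.trans_lt j.2) _
    · exact sup_le_sup_left (iSup_subtype_mono S fun l hl => hl.trans_lt j.2) _
  refine ⟨Σₗ i, κ i, inferInstance, wellFoundedLT_sigma_lex,
    fun j => G (ofLex j).1 (ofLex j).2, ?_, ?_⟩
  · rintro ⟨i, k⟩
    have h := hG i k
    have h1 := iSup_sigma_lex_lt G i k
    have h2 := iSup_sigma_lex_le G i k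
    simp only [← hS] at h1 h2
    rw [← hW, sup_assoc, sup_assoc] at h
    convert h using 2
    · exact h1
    · exact h2
  · rw [iSup_sigma_lex]
    simp only [← hS]
    refine le_antisymm (sup_le le_sup_left (iSup_le fun j => (hSle _).trans ?_))
      (sup_le le_sup_left (iSup_le fun i => (hle i).trans ?_))
    · exact sup_le_sup_left (iSup_subtype_le F _) _
    · exact sup_le_sup_left (iSup_subtype_le S _) _

theorem Filtered.le {A B : Submodule R N} (h : Filtered C A B) : A ≤ B := by
  obtain ⟨_, _, _, _, _, rfl⟩ := h
  exact le_sup_left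

/-- The case of `filtered_iSup` with two steps, `B` and then `D`. -/
theorem Filtered.trans {A B D : Submodule R N} (h1 : Filtered C A B) (h2 : Filtered C B D) :
    Filtered C A D := by
  let F : ULift.{u} Bool → Submodule R N := fun i => bif i.down then D else B
  have hlt0 : (⨆ j : {j // j < ULift.up.{u} false}, F j.1) = ⊥ := by
    refine eq_bot_iff.2 (iSup_le ?_)
    rintro ⟨⟨_ | _⟩, h⟩ <;> exact absurd h (by decide)
  have hle0 : (⨆ j : {j // j ≤ ULift.up.{u} false}, F j.1) = B := by
    refine le_antisymm (iSup_le ?_) (le_iSup_subtype F (i := ⟨false⟩) le_rfl)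
    rintro ⟨⟨_ | _⟩, h⟩
    · exact le_rfl
    · exact absurd h (by decide)
  have hlt1 : (⨆ j : {j // j < ULift.up.{u} true}, F j.1) = B := by
    refine le_antisymm (iSup_le ?_) (le_iSup_subtype F (i := ⟨false⟩) (by decide))
    rintro ⟨⟨_ | _⟩, h⟩
    · exact le_rfl
    · exact absurd h (by decide)
  have hle1 : (⨆ j : {j // j ≤ ULift.up.{u} true}, F j.1) = D := by
    refine le_antisymm (iSup_le ?_) (le_iSup_subtype F (i := ⟨true⟩) le_rfl)
    rintro ⟨⟨_ | _⟩, h⟩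
    · exact h2.le
    · exact le_rfl
  have ht : (⨆ j, F j) = D := by
    refine le_antisymm (iSup_le ?_) (le_iSup F ⟨true⟩)
    rintro ⟨_ | _⟩
    · exact h2.le
    · exact le_rfl
  have := filtered_iSup (C := C) (A := A) (F := F) (by
    rintro ⟨_ | _⟩
    · rwa [hlt0, hle0, sup_bot_eq, sup_eq_right.2 h1.le]
    · rwa [hlt1, hle1, sup_eq_right.2 h1.le, sup_eq_right.2 (h1.le.trans h2.le)])
  rwa [ht, sup_eq_right.2 (h1.le.trans h2.le)] at this

end Filtered
-- Direct sums of copies of a filtered module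
theorem iSup_supported_singleton {I M : Type*} [AddCommGroup M] [Module R M] (p : I → Prop) :
    (⨆ j : {j // p j}, Finsupp.supported M R {j.1}) = Finsupp.supported M R {j | p j} := by
  rw [← Finsupp.supported_iUnion]
  congr 1
  ext j
  simp

/-- A class of filtered modules is closed under direct sums of copies of one module. -/
theorem Filt.finsupp {C : ObjectProperty (ModuleCat.{u} R)} {M : ModuleCat.{u} R}
    (hM : Filt C M) (I : Type u) : Filt C (ModuleCat.of R (I →₀ M)) := by
  classical
  obtain ⟨_, _⟩ := exists_wellFoundedLT I
  refine Filtered.isFiltered (M := ModuleCat.of R (I →₀ M)) ?_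
  have key := filtered_iSup (C := C) (A := (⊥ : Submodule R (I →₀ M)))
    (F := fun i => Finsupp.supported M R {i}) ?_
  · rw [← Finsupp.supported_iUnion, Set.iUnion_singleton_eq_range, Set.range_id',
      Finsupp.supported_univ, bot_sup_eq] at key
    exact key
  intro i
  rw [iSup_supported_singleton, iSup_supported_singleton, bot_sup_eq, bot_sup_eq]
  -- For a well-order on `I`, the `i`-th coordinate identifies the `i`-th factor with `M`.
  refine (filt_iff_filtered (Finsupp.supported_mono fun j hj => le_of_lt hj)
    (f := Finsupp.lapply i ∘ₗ Submodule.subtype _) ?_ ?_).1 hM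
  · intro m
    exact ⟨⟨Finsupp.single i m, Finsupp.single_mem_supported R m le_rfl⟩,
      Finsupp.single_eq_same⟩
  · ext ⟨x, hx⟩
    rw [mem_submoduleOf_iff, LinearMap.mem_ker, Finsupp.mem_supported']
    rw [Finsupp.mem_supported'] at hx
    change x i = 0 ↔ _
    constructor
    · intro h j hj
      by_cases hji : j = i
      · rwa [hji]
      · exact hx j fun hj' => hj (lt_of_le_of_ne hj' hji)
    · exact fun h => h i (lt_irrefl i)

/-! ### Cardinality bounds -/

section Cardinality

theorem mk_finsupp_le {I M : Type u} [Zero M] {c : Cardinal.{u}} (hc : ℵ₀ ≤ c) (hI : #I ≤ c)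
    (hM : #M ≤ c) : #(I →₀ M) ≤ c := by
  rcases finite_or_infinite (I × M) with h | h
  · exact ((mk_le_of_injective (Finsupp.graph_injective I M)).trans
      (mk_lt_aleph0 (α := Finset (I × M))).le).trans hc
  · refine (mk_le_of_injective (Finsupp.graph_injective I M)).trans ?_
    rw [mk_finset_of_infinite, mk_prod, lift_id, lift_id]
    exact mul_le_of_le hc hI hM

theorem IsLTPresented.mk_le {c : Cardinal.{u}} (hc : ℵ₀ ≤ c) (hR : #R ≤ c)
    {X : ModuleCat.{u} R} (hX : IsLTPresented (Order.succ c) X) : #X ≤ c := by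
  obtain ⟨Y, f, _, hY, hf, _⟩ := hX
  exact (mk_le_of_surjective hf).trans (mk_finsupp_le hc (Order.lt_succ_iff.1 hY) hR)

/-- A union of a chain of submodules of cardinality less than `c` has cardinality at most `c`. -/
theorem mk_iSup_le_of_monotone {N : Type u} [AddCommGroup N] [Module R N] {ι : Type u}
    [LinearOrder ι] {c : Cardinal.{u}} (hc : ℵ₀ ≤ c) {T : ι → Submodule R N} (hT : Monotone T)
    (h : ∀ i, #(T i) < c) : #(⨆ i, T i : Submodule R N) ≤ c := by
  rcases isEmpty_or_nonempty ι with _ | _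
  · rw [iSup_of_empty]
    exact (mk_le_one_iff_set_subsingleton.2 (by simp)).trans (one_le_aleph0.trans hc)
  by_contra! hlt
  -- A subset `Y` of size `c` fits in no single `T i`, so the indices at which its elements appear
  -- are cofinal. The union is therefore one of `c` many small sets.
  obtain ⟨Y, hY, hYc⟩ := le_mk_iff_exists_subset.1 hlt.le
  have hmem : ∀ x : N, x ∈ (⨆ i, T i) ↔ ∃ i, x ∈ T i := fun x =>
    Submodule.mem_iSup_of_directed T hT.directed_le
  choose r hr using fun y : Y => (hmem y).1 (hY y.2)
  refine hlt.not_ge ?_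
  have hsub : ((⨆ i, T i : Submodule R N) : Set N) ⊆ ⋃ y, (T (r y) : Set N) := by
    intro x hx
    obtain ⟨i, hi⟩ := (hmem x).1 hx
    by_contra hx'
    have hle : ∀ y, r y ≤ i := fun y => by
      by_contra! hlt
      exact hx' (Set.mem_iUnion.2 ⟨y, hT hlt.le hi⟩)
    have : Y ⊆ T i := fun y hy => hT (hle ⟨y, hy⟩) (hr ⟨y, hy⟩)
    exact ((h i).trans_eq hYc.symm).not_ge (mk_le_mk_of_subset this)
  calc #(⨆ i, T i : Submodule R N) ≤ #(⋃ y, (T (r y) : Set N)) := mk_le_mk_of_subset hsub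
    _ ≤ #Y * ⨆ y, #(T (r y)) := mk_iUnion_le _
    _ ≤ c := mul_le_of_le hc hYc.le (ciSup_le' fun y => (h _).le)

/-- `B` is covered by the translates of `A` by representatives of the elements of the factor. -/
theorem IsFactor.mk_map_le {N Q : Type u} [AddCommGroup N] [Module R N] [AddCommGroup Q]
    [Module R Q] {C : ObjectProperty (ModuleCat.{u} R)} {A B : Submodule R N} (h : IsFactor C A B)
    {c : Cardinal.{u}} (hc : ℵ₀ ≤ c) (hC : ∀ X, C X → #X ≤ c) (g : N →ₗ[R] Q)
    (hA : #(A.map g) ≤ c) : #(B.map g) ≤ c := by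
  obtain ⟨X, hX, f, hf, hk⟩ := h
  let s : X → B := Function.surjInv hf
  have hs : ∀ x, f (s x) = x := Function.surjInv_eq hf
  have hsub : (B.map g : Set Q) ⊆ Set.range fun p : A.map g × X => p.1.1 + g (s p.2) := by
    rintro _ ⟨b, hb, rfl⟩
    have hmem : (⟨b, hb⟩ - s (f ⟨b, hb⟩) : B) ∈ A.submoduleOf B := by
      rw [← hk, LinearMap.mem_ker, map_sub, hs, sub_self]
    refine ⟨⟨⟨_, Submodule.mem_map_of_mem hmem⟩, f ⟨b, hb⟩⟩, ?_⟩
    simp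
  refine (mk_le_mk_of_subset hsub).trans (mk_range_le.trans ?_)
  rw [mk_prod, lift_id, lift_id]
  exact mul_le_of_le hc hA (hC X hX)

end Cardinality

/-! ### Splitting of extensions by strong splitters -/

section Splitting

theorem IsStrongSplitter.exists_section {M : ModuleCat.{u} R} (hM : IsStrongSplitter M)
    {E J : Type u} [AddCommGroup E] [Module R E] (p : E →ₗ[R] M) (hp : Function.Surjective p)
    (e : (J →₀ M) ≃ₗ[R] LinearMap.ker p) : ∃ s : M →ₗ[R] E, p ∘ₗ s = LinearMap.id := by
  have := hM J
  let i : (J →₀ M) →ₗ[R] E := (LinearMap.ker p).subtype ∘ₗ e.toLinearMap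
  have hexact : Function.Exact i p := by
    intro x
    constructor
    · intro hx
      exact ⟨e.symm ⟨x, hx⟩, by simp [i]⟩
    · rintro ⟨y, rfl⟩
      exact (e y).2
  let S : ShortComplex (ModuleCat.{u} R) :=
    ModuleCat.shortComplexOfCompEqZero i p hexact.linearMap_comp_eq_zero
  have hS : S.ShortExact := ModuleCat.shortComplex_shortExact S hexact
    ((Submodule.injective_subtype _).comp e.injective) hp
  -- The obstruction to lifting the identity of `M` lies in Ext¹(M, M^(J)) = 0.
  obtain ⟨x, hx⟩ := Abelian.Ext.covariant_sequence_exact₃ M hS (Abelian.Ext.mk₀ (𝟙 M))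
    (zero_add 1) (Subsingleton.elim (α := Abelian.Ext M (ModuleCat.of R (J →₀ M)) 1) _ _)
  obtain ⟨s, rfl⟩ := (Abelian.Ext.mk₀_bijective M S.X₂).2 x
  rw [Abelian.Ext.mk₀_comp_mk₀] at hx
  have hs : s ≫ S.g = 𝟙 M := (Abelian.Ext.mk₀_bijective M S.X₃).1 hx
  exact ⟨s.hom, congrArg ModuleCat.Hom.hom hs⟩

/-- Sections over the single copies of `M` assemble to one over the direct sum. Over the `i`-th
copy, the extension restricts to its preimage `E'`, with the same kernel. -/
theorem IsStrongSplitter.exists_section_finsupp {M : ModuleCat.{u} R} (hM : IsStrongSplitter M)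
    {E I J : Type u} [AddCommGroup E] [Module R E] (p : E →ₗ[R] (I →₀ M))
    (hp : Function.Surjective p) (e : (J →₀ M) ≃ₗ[R] LinearMap.ker p) :
    ∃ s : (I →₀ M) →ₗ[R] E, p ∘ₗ s = LinearMap.id := by
  classical
  have h : ∀ i, ∃ s : M →ₗ[R] E, p ∘ₗ s = Finsupp.lsingle i := by
    intro i
    let E' : Submodule R E := (LinearMap.range (Finsupp.lsingle (R := R) (M := M) i)).comap p
    let p' : E' →ₗ[R] M := Finsupp.lapply i ∘ₗ p ∘ₗ E'.subtype
    have hp' : ∀ x : E', p x = Finsupp.single i (p' x) := by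
      rintro ⟨x, m, hm⟩
      change p x = Finsupp.single i (p x i)
      rw [← hm]
      simp
    have hsurj : Function.Surjective p' := by
      intro m
      obtain ⟨x, hx⟩ := hp (Finsupp.single i m)
      refine ⟨⟨x, m, hx.symm⟩, ?_⟩
      change p x i = m
      rw [hx, Finsupp.single_eq_same]
    have hle : LinearMap.ker p ≤ E' := fun x hx => ⟨0, by rw [LinearMap.mem_ker.1 hx, map_zero]⟩
    have hker : LinearMap.ker p' = (LinearMap.ker p).submoduleOf E' := by
      ext x
      rw [mem_submoduleOf_iff, LinearMap.mem_ker, LinearMap.mem_ker, hp', Finsupp.single_eq_zero]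
    obtain ⟨s, hs⟩ := hM.exists_section p' hsurj
      ((e.trans (Submodule.submoduleOfEquivOfLe hle).symm).trans
        (LinearEquiv.ofEq _ _ hker.symm))
    refine ⟨E'.subtype ∘ₗ s, LinearMap.ext fun m => ?_⟩
    have := LinearMap.congr_fun hs m
    change p' (s m) = m at this
    change p (s m) = Finsupp.single i m
    rw [hp', this]
  choose s hs using h
  refine ⟨Finsupp.lsum ℕ s, Finsupp.lhom_ext' fun i => ?_⟩
  rw [LinearMap.comp_assoc, Finsupp.lsum_comp_lsingle, hs, LinearMap.id_comp]

end Splitting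

/-! ### Segments of a filtration -/

section Segments

variable {N : Type u} [AddCommGroup N] [Module R N] {C : ObjectProperty (ModuleCat.{u} R)}
  {ι : Type u} [LinearOrder ι]

/-- Every element of `L` precedes every element of `L' \ L`, so the latter indexes the filtration of
the quotient with the original factors. -/
theorem filtered_of_isLowerSet [WellFoundedLT ι] {F : ι → Submodule R N}
    (hF : ∀ i, IsFactor C (⨆ j : {j // j < i}, F j.1) (⨆ j : {j // j ≤ i}, F j.1))
    {L L' : Set ι} (hL : IsLowerSet L) (hL' : IsLowerSet L') (hLL' : L ⊆ L') :
    Filtered C (⨆ j : {j // j ∈ L}, F j.1) (⨆ j : {j // j ∈ L'}, F j.1) := by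
  have key : ∀ p : ι → Prop, (∀ j ∈ L, p j) → (∀ j, p j → j ∈ L') →
      (⨆ j : {j // j ∈ L}, F j.1) ⊔ (⨆ j : {j : {j // j ∈ L' ∧ j ∉ L} // p j.1}, F j.1.1) =
        ⨆ j : {j // p j}, F j.1 := by
    intro p h1 h2
    refine le_antisymm (sup_le (iSup_subtype_mono F h1)
      (iSup_le fun j => le_iSup_subtype F j.2)) (iSup_le fun j => ?_)
    by_cases hj : j.1 ∈ L
    · exact le_sup_of_le_left (le_iSup_subtype F hj)
    · exact le_sup_of_le_right (le_iSup (fun j : {j : {j // j ∈ L' ∧ j ∉ L} // p j.1} => F j.1.1)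
        ⟨⟨j.1, h2 _ j.2, hj⟩, j.2⟩)
  have hlt : ∀ i ∉ L, ∀ j ∈ L, j < i := fun i hi j hj => by
    by_contra! h
    exact hi (hL h hj)
  refine ⟨{j // j ∈ L' ∧ j ∉ L}, inferInstance, inferInstance, fun j => F j.1, fun i => ?_, ?_⟩
  · have h1 := key (· < i.1) (hlt _ i.2.2) fun j hj => hL' hj.le i.2.1
    have h2 := key (· ≤ i.1) (fun j hj => (hlt _ i.2.2 j hj).le) fun j hj => hL' hj i.2.1
    have h := hF i.1
    rw [← h1, ← h2] at h
    exact h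
  · refine le_antisymm (sup_le (iSup_subtype_mono F hLL') (iSup_le fun j => ?_))
      (iSup_le fun j => ?_)
    · exact le_iSup_subtype F j.2.1
    · by_cases hj : j.1 ∈ L
      · exact le_sup_of_le_left (le_iSup_subtype F hj)
      · exact le_sup_of_le_right (le_iSup (fun j : {j // j ∈ L' ∧ j ∉ L} => F j.1)
          ⟨j.1, j.2, hj⟩)

/-- A quotient of a filtered module with small factors contains the image of a segment of the
filtration of any given large cardinality. -/
theorem exists_isLowerSet_mk_eq [WellFoundedLT ι] {F : ι → Submodule R N}
    (hF : ∀ i, IsFactor C (⨆ j : {j // j < i}, F j.1) (⨆ j : {j // j ≤ i}, F j.1))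
    (htop : ⨆ i, F i = ⊤) {c : Cardinal.{u}} (hc : ℵ₀ ≤ c) (hC : ∀ X, C X → #X ≤ c)
    {Q : Type u} [AddCommGroup Q] [Module R Q] {g : N →ₗ[R] Q} (hg : Function.Surjective g)
    (hQ : c ≤ #Q) :
    ∃ L : Set ι, IsLowerSet L ∧ #((⨆ j : {j // j ∈ L}, F j.1).map g) = c := by
  let T : ι → Submodule R Q := fun i => (⨆ j : {j // j ≤ i}, F j.1).map g
  have hT : Monotone T := fun i j hij =>
    Submodule.map_mono (iSup_subtype_mono F fun l hl => hl.trans hij)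
  have hFT : ∀ i, (F i).map g ≤ T i := fun i => Submodule.map_mono (le_iSup_subtype F le_rfl)
  by_cases h : ∃ i, c ≤ #(T i)
  -- The first image of size at least `c` does not overshoot: the earlier ones have size below `c`,
  -- their union at most `c`, and one more factor keeps this bound.
  · obtain ⟨i, hi, hmin⟩ := wellFounded_lt.has_min {i | c ≤ #(T i)} h
    refine ⟨Set.Iic i, isLowerSet_Iic i, le_antisymm ?_ hi⟩
    refine (hF i).mk_map_le hc hC g ((mk_le_mk_of_subset ?_).trans (mk_iSup_le_of_monotone hc
      (T := fun j : {j // j < i} => T j.1) (fun _ _ h => hT h)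
      fun j => not_le.1 fun hj => hmin _ hj j.2))
    rw [Submodule.map_iSup]
    exact SetLike.coe_subset_coe.2 (iSup_mono fun j => hFT j.1)
  · push Not at h
    refine ⟨Set.univ, isLowerSet_univ, ?_⟩
    have h1 : (⨆ j : {j // j ∈ (Set.univ : Set ι)}, F j.1) = ⊤ :=
      eq_top_iff.2 (htop ▸ iSup_le fun i => le_iSup_subtype F (Set.mem_univ i))
    have h2 : (⨆ i, T i) = ⊤ := by
      rw [eq_top_iff, ← LinearMap.range_eq_top.2 hg, LinearMap.range_eq_map, ← htop,
        Submodule.map_iSup]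
      exact iSup_mono hFT
    rw [h1, Submodule.map_top, LinearMap.range_eq_top.2 hg]
    refine le_antisymm ?_ (hQ.trans_eq mk_univ.symm)
    rw [← h2]
    exact mk_iSup_le_of_monotone hc hT h

end Segments

/-! ### Independent families of homomorphisms from M -/

section Families

variable {M N : Type u} [AddCommGroup M] [Module R M] [AddCommGroup N] [Module R N]

variable (R M N) in
/-- The map `M^(Hom(M, N)) → N` evaluating all homomorphisms `M → N`. -/
noncomputable def homSum : ((M →ₗ[R] N) →₀ M) →ₗ[R] N := Finsupp.lsum ℕ id

/-- The sum of the images of the homomorphisms in `Φ`. -/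
noncomputable def famSum (Φ : Set (M →ₗ[R] N)) : Submodule R N :=
  (Finsupp.supported M R Φ).map (homSum R M N)

/-- The maps in `Φ` identify `famSum Φ` with a direct sum of copies of `M`. -/
def FamIndep (Φ : Set (M →ₗ[R] N)) : Prop :=
  Disjoint (Finsupp.supported M R Φ) (LinearMap.ker (homSum R M N))

theorem famSum_mono {Φ Ψ : Set (M →ₗ[R] N)} (h : Φ ⊆ Ψ) : famSum Φ ≤ famSum Ψ :=
  Submodule.map_mono (Finsupp.supported_mono h)

theorem famSum_union (Φ Ψ : Set (M →ₗ[R] N)) : famSum (Φ ∪ Ψ) = famSum Φ ⊔ famSum Ψ := by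
  rw [famSum, Finsupp.supported_union, Submodule.map_sup]
  rfl

theorem famSum_sUnion (c : Set (Set (M →ₗ[R] N))) : famSum (⋃₀ c) = ⨆ Φ : c, famSum Φ.1 := by
  rw [famSum, Set.sUnion_eq_iUnion, Finsupp.supported_iUnion, Submodule.map_iSup]
  rfl

theorem FamIndep.mono {Φ Ψ : Set (M →ₗ[R] N)} (h : Φ ⊆ Ψ) (hΨ : FamIndep Ψ) : FamIndep Φ :=
  Disjoint.mono_left (Finsupp.supported_mono h) hΨ

theorem FamIndep.eq_zero {Φ : Set (M →ₗ[R] N)} (h : FamIndep Φ) {x : (M →ₗ[R] N) →₀ M}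
    (hx : x ∈ Finsupp.supported M R Φ) (h0 : homSum R M N x = 0) : x = 0 :=
  Submodule.disjoint_def.1 h x hx h0

theorem FamIndep.equiv {Φ : Set (M →ₗ[R] N)} (h : FamIndep Φ) :
    Nonempty ((Φ →₀ M) ≃ₗ[R] famSum Φ) := by
  have hb : Function.Bijective ((homSum R M N).submoduleMap (Finsupp.supported M R Φ)) := by
    refine ⟨(injective_iff_map_eq_zero _).2 fun x hx => ?_, LinearMap.submoduleMap_surjective _ _⟩
    exact Subtype.ext (h.eq_zero x.2 (congrArg Subtype.val hx))
  exact ⟨(Finsupp.supportedEquivFinsupp Φ).symm.trans (LinearEquiv.ofBijective _ hb)⟩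

theorem FamIndep.union {Φ Ψ : Set (M →ₗ[R] N)} (hΦ : FamIndep Φ) (hΨ : FamIndep Ψ)
    (h : Disjoint (famSum Φ) (famSum Ψ)) : FamIndep (Φ ∪ Ψ) := by
  refine Submodule.disjoint_def.2 fun x hx h0 => ?_
  rw [Finsupp.supported_union] at hx
  obtain ⟨y, hy, z, hz, rfl⟩ := Submodule.mem_sup.1 hx
  rw [LinearMap.mem_ker, map_add] at h0
  have h1 : homSum R M N y = 0 := by
    refine Submodule.disjoint_def.1 h _ (Submodule.mem_map_of_mem hy) ?_
    rw [eq_neg_of_add_eq_zero_left h0]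
    exact neg_mem (Submodule.mem_map_of_mem hz)
  rw [h1, zero_add] at h0
  rw [hΦ.eq_zero hy h1, hΨ.eq_zero hz h0, add_zero]

theorem FamIndep.disjoint {Φ Ψ : Set (M →ₗ[R] N)} (h : FamIndep (Φ ∪ Ψ)) (hd : Disjoint Φ Ψ) :
    Disjoint (famSum Φ) (famSum Ψ) := by
  refine Submodule.disjoint_def.2 ?_
  rintro _ ⟨y, hy, rfl⟩ ⟨z, hz, hzy⟩
  have h1 : y - z = 0 := by
    refine h.eq_zero (sub_mem (Finsupp.supported_mono Set.subset_union_left hy)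
      (Finsupp.supported_mono Set.subset_union_right hz)) ?_
    rw [map_sub, hzy, sub_self]
  rw [sub_eq_zero] at h1
  rw [Submodule.disjoint_def.1 (Finsupp.disjoint_supported_supported hd) y hy (h1 ▸ hz), map_zero]

theorem famIndep_sUnion {c : Set (Set (M →ₗ[R] N))} (hc : IsChain (· ⊆ ·) c)
    (h : ∀ Φ ∈ c, FamIndep Φ) : FamIndep (⋃₀ c) := by
  refine Submodule.disjoint_def.2 fun x hx h0 => ?_
  rcases c.eq_empty_or_nonempty with rfl | hne
  · simpa using hx
  have := hne.to_subtype
  rw [Set.sUnion_eq_iUnion, Finsupp.supported_iUnion, Submodule.mem_iSup_of_directed] at hx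
  · obtain ⟨Φ, hΦ⟩ := hx
    exact (h _ Φ.2).eq_zero hΦ h0
  · intro Φ Ψ
    obtain ⟨Υ, hΥ, h1, h2⟩ := hc.directedOn Φ Φ.2 Ψ Ψ.2
    exact ⟨⟨Υ, hΥ⟩, Finsupp.supported_mono h1, Finsupp.supported_mono h2⟩

variable {I : Type u}

/-- The components of a homomorphism defined on `M^(I)`. -/
noncomputable def components (t : (I →₀ M) →ₗ[R] N) : Set (M →ₗ[R] N) :=
  Set.range fun i => t ∘ₗ Finsupp.lsingle i

theorem supported_components (t : (I →₀ M) →ₗ[R] N) : Finsupp.supported M R (components t) =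
    LinearMap.range (Finsupp.lmapDomain M R fun i => t ∘ₗ Finsupp.lsingle i) := by
  rw [components, ← Set.image_univ, ← Finsupp.lmapDomain_supported, Finsupp.supported_univ,
    Submodule.map_top]

theorem homSum_comp_lmapDomain (t : (I →₀ M) →ₗ[R] N) :
    homSum R M N ∘ₗ Finsupp.lmapDomain M R (fun i => t ∘ₗ Finsupp.lsingle i) = t := by
  ext i m
  simp [homSum]

theorem famSum_components (t : (I →₀ M) →ₗ[R] N) : famSum (components t) = LinearMap.range t := by
  rw [famSum, supported_components, ← LinearMap.range_comp, homSum_comp_lmapDomain]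

theorem famIndep_components {t : (I →₀ M) →ₗ[R] N} (ht : Function.Injective t) :
    FamIndep (components t) := by
  refine Submodule.disjoint_def.2 fun x hx h0 => ?_
  rw [supported_components] at hx
  obtain ⟨z, rfl⟩ := hx
  have h1 : t z = 0 := by
    rw [← homSum_comp_lmapDomain t]
    exact h0
  rw [(map_eq_zero_iff t ht).1 h1, map_zero]

end Families

/-! ### Upward transfer of categoricity -/

theorem mk_finsupp_eq {I M : Type u} [Zero M] [Nontrivial M] {c : Cardinal.{u}} (hc : ℵ₀ ≤ c)
    (hI : #I = c) (hM : #M ≤ c) : #(I →₀ M) = c := by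
  have : Infinite I := infinite_iff.2 (hI ▸ hc)
  rw [mk_finsupp_of_infinite, hI, max_eq_left hM]

/-- In a `c`-categorical class closed under direct sums, the modules of cardinality `c` are the
direct sums of `c` copies of any small nontrivial member. -/
theorem IsCategorical.equiv_finsupp {C : ObjectProperty (ModuleCat.{u} R)} {c : Cardinal.{u}}
    (hcat : IsCategorical c (Filt C)) {M : ModuleCat.{u} R} [Nontrivial M] (hMC : Filt C M)
    (hM : #M ≤ c) {Q : ModuleCat.{u} R} (hQ : Filt C Q) (hQc : #Q = c) {I : Type u} (hI : #I = c) :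
    Nonempty (Q ≃ₗ[R] (I →₀ M)) :=
  hcat.2.2 Q (ModuleCat.of R (I →₀ M)) hQ (hMC.finsupp I) hQc (mk_finsupp_eq hcat.1 hI hM)

section

variable {N : Type u} [AddCommGroup N] [Module R N]

/-- The restriction of the quotient map by `A` to `B`, as a map onto its image. -/
def mkQOn (A B : Submodule R N) : B →ₗ[R] B.map A.mkQ := A.mkQ.submoduleMap B

theorem mkQOn_surjective (A B : Submodule R N) : Function.Surjective (mkQOn A B) :=
  LinearMap.submoduleMap_surjective _ _

theorem ker_mkQOn (A B : Submodule R N) : LinearMap.ker (mkQOn A B) = A.submoduleOf B := by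
  ext x
  rw [LinearMap.mem_ker, mem_submoduleOf_iff, ← Submodule.Quotient.mk_eq_zero A]
  exact Subtype.ext_iff

/-- A maximal independent family whose sum is a segment of the filtration leaves a small
quotient. -/
theorem exists_famIndep_mk_quotient_lt {C : ObjectProperty (ModuleCat.{u} R)} {c : Cardinal.{u}}
    (hcat : IsCategorical c (Filt C)) (hC : ∀ X, C X → #X ≤ c) {M : ModuleCat.{u} R}
    [Nontrivial M] (hMC : Filt C M) (hM : #M ≤ c) (hMs : IsStrongSplitter M)
    (hN : Filtered C (⊥ : Submodule R N) ⊤) :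
    ∃ Φ : Set (M →ₗ[R] N), FamIndep Φ ∧ Filtered C (famSum Φ) ⊤ ∧ #(N ⧸ famSum Φ) < c := by
  obtain ⟨ι, _, _, F, hF, htop⟩ := hN
  simp only [bot_sup_eq] at hF htop
  have hS : ∀ c' : Set (Set ι), (⨆ j : {j // j ∈ ⋃₀ c'}, F j.1) =
      ⨆ L : c', ⨆ j : {j // j ∈ L.1}, F j.1 := by
    intro c'
    refine le_antisymm (iSup_le ?_) (iSup_le fun L => iSup_subtype_mono F fun j hj =>
      ⟨L.1, L.2, hj⟩)
    rintro ⟨j, L, hL, hj⟩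
    have h1 : F j ≤ ⨆ j : {j // j ∈ L}, F j.1 := le_iSup_subtype F hj
    exact h1.trans (le_iSup (fun L : c' => ⨆ j : {j // j ∈ L.1}, F j.1) ⟨L, hL⟩)
  -- Requiring the sum to be a segment keeps quotients of later segments by it in the class, so that
  -- categoricity applies to them.
  let Z : Set (Set (M →ₗ[R] N)) := {Φ | FamIndep Φ ∧
      ∃ L : Set ι, IsLowerSet L ∧ famSum Φ = ⨆ j : {j // j ∈ L}, F j.1}
  have hZ : ∀ c' ⊆ Z, IsChain (· ⊆ ·) c' → ∃ ub ∈ Z, ∀ s ∈ c', s ⊆ ub := by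
    intro c' hc' hchain
    have hex : ∀ Φ ∈ c', ∃ L : Set ι, IsLowerSet L ∧ famSum Φ = ⨆ j : {j // j ∈ L}, F j.1 :=
      fun Φ hΦ => (hc' hΦ).2
    choose! L hL hLe using hex
    refine ⟨⋃₀ c', ⟨famIndep_sUnion hchain fun Φ hΦ => (hc' hΦ).1, ⋃₀ (L '' c'), ?_, ?_⟩,
      fun _ => Set.subset_sUnion_of_mem⟩
    · refine isLowerSet_sUnion ?_
      rintro _ ⟨Φ, hΦ, rfl⟩
      exact hL Φ hΦ
    · rw [famSum_sUnion, hS]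
      refine le_antisymm (iSup_le fun Φ => ?_) (iSup_le ?_)
      · rw [hLe _ Φ.2]
        exact le_iSup (fun L : L '' c' => ⨆ j : {j // j ∈ L.1}, F j.1)
          ⟨_, Set.mem_image_of_mem _ Φ.2⟩
      · rintro ⟨_, Φ, hΦ, rfl⟩
        rw [← hLe _ hΦ]
        exact le_iSup (fun Φ : c' => famSum Φ.1) ⟨Φ, hΦ⟩
  obtain ⟨Φ, hΦ⟩ := zorn_subset Z hZ
  obtain ⟨hind, L, hL, hΦL⟩ := hΦ.prop
  refine ⟨Φ, hind, ?_, ?_⟩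
  · have := filtered_of_isLowerSet hF hL isLowerSet_univ (Set.subset_univ L)
    rw [← hΦL] at this
    have h1 : (⨆ j : {j // j ∈ (Set.univ : Set ι)}, F j.1) = ⊤ :=
      eq_top_iff.2 (htop ▸ iSup_le fun i => le_iSup_subtype F (Set.mem_univ i))
    rwa [h1] at this
  by_contra! hlt
  obtain ⟨L₀, hL₀, hcard⟩ := exists_isLowerSet_mk_eq hF htop hcat.1 hC
    (Submodule.mkQ_surjective (famSum Φ)) hlt
  have hfil := filtered_of_isLowerSet hF hL (hL.union hL₀) Set.subset_union_left
  have hBL : (⨆ j : {j // j ∈ L ∪ L₀}, F j.1) = famSum Φ ⊔ ⨆ j : {j // j ∈ L₀}, F j.1 := by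
    rw [hΦL]
    refine le_antisymm (iSup_le ?_) (sup_le (iSup_subtype_mono F fun j => Or.inl)
      (iSup_subtype_mono F fun j => Or.inr))
    rintro ⟨j, hj | hj⟩
    · exact le_sup_of_le_left (le_iSup_subtype F hj)
    · exact le_sup_of_le_right (le_iSup_subtype F hj)
  rw [← hΦL] at hfil
  have hmaxeq : ∀ L', IsLowerSet L' → ∀ Ψ : Set (M →ₗ[R] N), FamIndep (Φ ∪ Ψ) →
      famSum (Φ ∪ Ψ) = (⨆ j : {j // j ∈ L'}, F j.1) → famSum Ψ ≤ famSum Φ := fun L' hL' Ψ h1 h2 =>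
    famSum_mono (Set.subset_union_right.trans
      (hΦ.le_of_ge (y := Φ ∪ Ψ) ⟨h1, L', hL', h2⟩ Set.subset_union_left))
  replace hmaxeq := hmaxeq _ (hL.union hL₀)
  generalize (⨆ j : {j // j ∈ L ∪ L₀}, F j.1) = B at *
  have hBcard : #(B.map (famSum Φ).mkQ) = c := by
    rw [hBL, Submodule.map_sup, Submodule.mkQ_map_self, bot_sup_eq]
    exact hcard
  have hQ : Filt C (ModuleCat.of R (B.map (famSum Φ).mkQ)) :=
    (filt_iff_filtered hfil.le (mkQOn_surjective _ _) (ker_mkQOn _ _)).2 hfil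
  obtain ⟨e⟩ := hcat.equiv_finsupp hMC hM hQ hBcard (mk_out c)
  let p : B →ₗ[R] (c.out →₀ M) := e.toLinearMap ∘ₗ mkQOn (famSum Φ) B
  have hp : Function.Surjective p := e.surjective.comp (mkQOn_surjective _ _)
  have hpk : LinearMap.ker p = (famSum Φ).submoduleOf B := by
    rw [LinearMap.ker_comp, LinearEquiv.ker]
    exact ker_mkQOn _ _
  obtain ⟨e'⟩ := hind.equiv
  obtain ⟨s, hs⟩ := hMs.exists_section_finsupp p hp
    ((e'.trans (Submodule.submoduleOfEquivOfLe hfil.le).symm).trans (LinearEquiv.ofEq _ _ hpk.symm))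
  have hs' : ∀ z, p (s z) = z := LinearMap.congr_fun hs
  have hpA : ∀ b : B, p b = 0 ↔ (b : N) ∈ famSum Φ := fun b => by
    rw [← LinearMap.mem_ker, hpk, mem_submoduleOf_iff]
  have ht : Function.Injective (B.subtype ∘ₗ s) :=
    B.injective_subtype.comp (Function.LeftInverse.injective hs')
  have hdisj : Disjoint (famSum Φ) (famSum (components (B.subtype ∘ₗ s))) := by
    rw [famSum_components]
    refine Submodule.disjoint_def.2 ?_
    rintro _ hx ⟨z, rfl⟩
    have : p (s z) = 0 := (hpA _).2 hx
    rw [hs'] at this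
    rw [this, map_zero]
  -- The components of the section extend `Φ` to a decomposition of `B`. Maximality puts their sum
  -- inside `famSum Φ`, from which it is disjoint, so the injective section would vanish on a
  -- nonzero module.
  have hle := hmaxeq (components (B.subtype ∘ₗ s)) (hind.union (famIndep_components ht) hdisj) (by
    rw [famSum_union, famSum_components]
    refine le_antisymm (sup_le hfil.le ?_) fun b hb => ?_
    · rintro _ ⟨z, rfl⟩
      exact (s z).2
    · refine Submodule.mem_sup.2 ⟨(⟨b, hb⟩ - s (p ⟨b, hb⟩) : B), (hpA _).1 ?_,
        s (p ⟨b, hb⟩), ⟨_, rfl⟩, ?_⟩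
      · rw [map_sub, hs', sub_self]
      · simp)
  have hbot := hdisj.eq_bot_of_ge hle
  rw [famSum_components, LinearMap.range_eq_bot] at hbot
  have : Nonempty c.out := mk_ne_zero_iff.1 (by
    rw [mk_out]
    exact (aleph0_pos.trans_le hcat.1).ne')
  obtain ⟨x, hx⟩ := exists_ne (0 : c.out →₀ M)
  exact hx (ht (by rw [hbot]; rfl))

/-- A large filtered module is a direct sum of copies of `M` as soon as it is one up to a small
filtered quotient. -/
theorem exists_equiv_finsupp_of_famIndep {C : ObjectProperty (ModuleCat.{u} R)} {c : Cardinal.{u}}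
    (hcat : IsCategorical c (Filt C)) (hR : #R ≤ c) {M : ModuleCat.{u} R}
    [Nontrivial M] (hMC : Filt C M) (hM : #M ≤ c) (hN : c < #N) {Φ : Set (M →ₗ[R] N)}
    (hΦ : FamIndep Φ) (hfil : Filtered C (famSum Φ) ⊤) (hlt : #(N ⧸ famSum Φ) < c) :
    ∃ I : Type u, Nonempty (N ≃ₗ[R] (I →₀ M)) := by
  have hc := hcat.1
  have hmk : ∀ Ψ ⊆ Φ, #(famSum Ψ) = #(Ψ →₀ M) := fun Ψ hΨ => by
    obtain ⟨e⟩ := (hΦ.mono hΨ).equiv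
    exact mk_congr e.toEquiv.symm
  have hΦc : c ≤ #Φ := by
    by_contra! h
    refine hN.not_ge ?_
    have e : N ≃ (N ⧸ famSum Φ) × famSum Φ :=
      AddSubgroup.addGroupEquivQuotientProdAddSubgroup (s := (famSum Φ).toAddSubgroup)
    rw [mk_congr e, mk_prod, lift_id, lift_id]
    refine mul_le_of_le hc hlt.le ?_
    rw [hmk Φ le_rfl]
    exact mk_finsupp_le hc h.le hM
  -- Spanned by representatives of all cosets, so `H₀` maps onto the quotient and has size at most
  -- `c`.
  let H₀ : Submodule R N := LinearMap.range
    (Finsupp.linearCombination R (Quotient.out : (N ⧸ famSum Φ) → N))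
  have hH₀ : #H₀ ≤ c := mk_range_le.trans (mk_finsupp_le hc hlt.le hR)
  have hH₀top : ∀ q : N ⧸ famSum Φ, ∃ h ∈ H₀, (famSum Φ).mkQ h = q := fun q =>
    ⟨Quotient.out q, ⟨Finsupp.single q 1, by simp⟩, Quotient.out_eq q⟩
  choose x hx hxa using fun a : (H₀ ⊓ famSum Φ : Submodule R N) => a.2.2
  -- All summands occurring in elements of `H₀ ⊓ famSum Φ`; adding `J₁` below brings the size to
  -- exactly `c`.
  let J₀ : Set (M →ₗ[R] N) := ⋃ a, ((x a).support : Set (M →ₗ[R] N))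
  have hJ₀ : J₀ ⊆ Φ := Set.iUnion_subset fun a => (Finsupp.mem_supported R _).1 (hx a)
  have hJ₀c : #J₀ ≤ c := (mk_iUnion_le _).trans (mul_le_of_le hc
    ((mk_le_mk_of_subset inf_le_left).trans hH₀)
    (ciSup_le' fun a => (Finset.countable_toSet _).le_aleph0.trans hc))
  obtain ⟨J₁, hJ₁, hJ₁c⟩ := le_mk_iff_exists_subset.1 hΦc
  let J : Set (M →ₗ[R] N) := J₀ ∪ J₁
  have hJ : J ⊆ Φ := Set.union_subset hJ₀ hJ₁
  have hJc : #J = c := le_antisymm ((mk_union_le _ _).trans (add_le_of_le hc hJ₀c hJ₁c.le))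
    (hJ₁c.ge.trans (mk_le_mk_of_subset Set.subset_union_right))
  have hPc : #(famSum J) = c := (hmk J hJ).trans (mk_finsupp_eq hc hJc hM)
  have hinf : H₀ ⊓ famSum Φ ≤ famSum J := by
    intro a ha
    refine ⟨x ⟨a, ha⟩, ?_, hxa ⟨a, ha⟩⟩
    exact (Finsupp.mem_supported R _).2 ((Set.subset_iUnion
      (fun a => ((x a).support : Set (M →ₗ[R] N))) ⟨a, ha⟩).trans Set.subset_union_left)
  let H : Submodule R N := H₀ ⊔ famSum J
  have hHΦ : H ⊓ famSum Φ = famSum J := by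
    refine le_antisymm ?_ (le_inf le_sup_right (famSum_mono hJ))
    rw [show H = famSum J ⊔ H₀ from sup_comm _ _, sup_inf_assoc_of_le _ (famSum_mono hJ)]
    exact sup_le le_rfl hinf
  have hHc : #H = c := by
    refine le_antisymm ?_ (hPc.ge.trans (mk_le_mk_of_subset (SetLike.coe_subset_coe.2 le_sup_right)))
    have hsub : (H : Set N) ⊆ Set.range fun p : H₀ × famSum J => p.1.1 + p.2.1 := by
      intro h hh
      obtain ⟨y, hy, z, hz, rfl⟩ := Submodule.mem_sup.1 hh
      exact ⟨⟨⟨y, hy⟩, ⟨z, hz⟩⟩, rfl⟩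
    refine (mk_le_mk_of_subset hsub).trans (mk_range_le.trans ?_)
    rw [mk_prod, lift_id, lift_id]
    exact mul_le_of_le hc hH₀ hPc.le
  have hH : Filt C (ModuleCat.of R H) := by
    have h1 : Filtered C (⊥ : Submodule R N) (famSum J) := by
      obtain ⟨e⟩ := (hΦ.mono hJ).equiv
      refine (filt_iff_filtered bot_le (M := ModuleCat.of R (J →₀ M)) (f := e.symm.toLinearMap)
        e.symm.surjective ?_).1 (hMC.finsupp J)
      rw [LinearEquiv.ker, Submodule.submoduleOf, Submodule.comap_bot, Submodule.ker_subtype]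
    have h2 : Filt C (ModuleCat.of R (N ⧸ famSum Φ)) := by
      refine (filt_iff_filtered le_top (M := ModuleCat.of R (N ⧸ famSum Φ))
        (f := (famSum Φ).mkQ ∘ₗ Submodule.subtype ⊤) ?_ ?_).2 hfil
      · exact (Submodule.mkQ_surjective _).comp fun n => ⟨⟨n, trivial⟩, rfl⟩
      · rw [LinearMap.ker_comp, Submodule.ker_mkQ]
        rfl
    -- `H` maps onto `N ⧸ famSum Φ` with kernel `H ⊓ famSum Φ = famSum J`.
    have h3 : Filtered C (famSum J) H := by
      refine (filt_iff_filtered le_sup_right (M := ModuleCat.of R (N ⧸ famSum Φ))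
        (f := (famSum Φ).mkQ ∘ₗ H.subtype) ?_ ?_).1 h2
      · intro q
        obtain ⟨h, hh, hq⟩ := hH₀top q
        exact ⟨⟨h, le_sup_left (a := H₀) hh⟩, hq⟩
      · rw [LinearMap.ker_comp, Submodule.ker_mkQ]
        ext h
        rw [mem_submoduleOf_iff, ← hHΦ]
        exact ⟨fun hh => ⟨h.2, hh⟩, fun hh => hh.2⟩
    refine (filt_iff_filtered bot_le (M := ModuleCat.of R H) (f := LinearMap.id)
      Function.surjective_id ?_).2 (h1.trans h3)
    rw [LinearMap.ker_id, Submodule.submoduleOf, Submodule.comap_bot, Submodule.ker_subtype]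
  obtain ⟨e⟩ := hcat.equiv_finsupp hMC hM hH hHc (mk_out c)
  have hunion : J ∪ (Φ \ J) = Φ := Set.union_sdiff_cancel hJ
  have hcompl : IsCompl H (famSum (Φ \ J)) := by
    constructor
    · have hd : Disjoint (famSum J) (famSum (Φ \ J)) :=
        FamIndep.disjoint (hunion.symm ▸ hΦ) Set.disjoint_sdiff_right
      refine disjoint_iff_inf_le.2 (le_trans ?_ hd.le_bot)
      refine le_inf ?_ inf_le_right
      rw [← hHΦ]
      exact inf_le_inf_left _ (famSum_mono Set.sdiff_subset)
    · have h1 : famSum Φ ≤ H ⊔ famSum (Φ \ J) := by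
        rw [← hunion, famSum_union, hunion]
        exact sup_le_sup_right le_sup_right _
      refine codisjoint_iff_le_sup.2 fun n _ => ?_
      obtain ⟨h, hh, hq⟩ := hH₀top ((famSum Φ).mkQ n)
      have h2 : n - h ∈ famSum Φ := by
        rw [← Submodule.ker_mkQ (famSum Φ), LinearMap.mem_ker, map_sub, hq, sub_self]
      have h3 : h ∈ H ⊔ famSum (Φ \ J) := le_sup_left (a := H) (le_sup_left (a := H₀) hh)
      simpa using add_mem (h1 h2) h3
  obtain ⟨e'⟩ := (hΦ.mono Set.sdiff_subset : FamIndep (Φ \ J)).equiv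
  exact ⟨c.out ⊕ (Φ \ J : Set _), ⟨((Submodule.prodEquivOfIsCompl _ _ hcompl).symm.trans
    (e.prodCongr e'.symm)).trans (Finsupp.sumFinsuppLEquivProdFinsupp R).symm⟩⟩

end

/-- Categoricity of a class of filtered modules containing a strong splitter is inherited by larger
cardinals. -/
theorem IsCategorical.mono {C : ObjectProperty (ModuleCat.{u} R)} {c d : Cardinal.{u}}
    (hcat : IsCategorical c (Filt C)) (hcd : c ≤ d) (hR : #R ≤ c) (hC : ∀ X, C X → #X ≤ c)
    {M : ModuleCat.{u} R} [Nontrivial M] (hMC : Filt C M) (hM : #M ≤ c)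
    (hMs : IsStrongSplitter M) : IsCategorical d (Filt C) := by
  rcases hcd.eq_or_lt with rfl | hlt
  · exact hcat
  have hd := hcat.1.trans hcd
  have key : ∀ N : ModuleCat.{u} R, Filt C N → #N = d → Nonempty (N ≃ₗ[R] (d.out →₀ M)) := by
    intro N hN hNd
    obtain ⟨Φ, h1, h2, h3⟩ := exists_famIndep_mk_quotient_lt hcat hC hMC hM hMs
      (IsFiltered.filtered hN)
    obtain ⟨I, ⟨e⟩⟩ := exists_equiv_finsupp_of_famIndep hcat hR hMC hM (hNd ▸ hlt) h1 h2 h3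
    -- At most `c` copies of `M` would give cardinality at most `c < d`. So `I` has more than `c`
    -- elements, and the cardinality of the sum is that of `I`.
    have hI : #I = d := by
      have hIN : #(I →₀ M) = d := (mk_congr e.toEquiv).symm.trans hNd
      have hIc : c < #I := by
        by_contra! h
        exact (hIN ▸ hlt).not_ge (mk_finsupp_le hcat.1 h hM)
      exact (mk_finsupp_eq (hcat.1.trans hIc.le) rfl (hM.trans hIc.le)).symm.trans hIN
    obtain ⟨e'⟩ := Cardinal.eq.1 (hI.trans (mk_out d).symm)
    exact ⟨e.trans (Finsupp.domLCongr e')⟩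
  refine ⟨hd, ⟨ModuleCat.of R (d.out →₀ M), hMC.finsupp _,
    mk_finsupp_eq hd (mk_out d) (hM.trans hcd)⟩, fun N₁ N₂ h1 h2 hc1 hc2 => ?_⟩
  obtain ⟨e₁⟩ := key N₁ h1 hc1
  obtain ⟨e₂⟩ := key N₂ h2 hc2
  exact ⟨e₁.trans e₂.symm⟩

end ModuleClass

/-! ### The dichotomy for the spectrum -/

theorem corollary3p6 {R : Type u} [Ring R] (D : ObjectProperty (ModuleCat.{u} R))
    (hD : ModuleClass.IsDeconstructible D)
    (M : ModuleCat.{u} R) (hMD : D M) (hM0 : Nontrivial M)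
    (hM : ModuleClass.IsStrongSplitter M)
    (ν κ : Cardinal.{u})
    (hν : IsLeast {c : Cardinal.{u} |
      ℵ₀ ≤ c ∧ #R ≤ c ∧ ModuleClass.IsDeconstructibleAt (Order.succ c) D} ν)
    (hκ : IsLeast {c : Cardinal.{u} | ν ≤ c ∧ #M ≤ c} κ) :
    ModuleClass.categoricitySpectrum D ⊆ Set.Ico ν κ ∨
      ∃ l : Cardinal.{u}, κ ≤ l ∧
        ModuleClass.categoricitySpectrum D ∩ Set.Ici κ = Set.Ici l := by
  have hdec : ModuleClass.deconstructionCardinal D = ν :=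
    (ModuleClass.isLeast_deconstructionCardinal hD).unique hν
  obtain ⟨⟨hν0, hR, -, C, -, -, hC, rfl⟩, -⟩ := hν
  obtain ⟨⟨hνκ, hMκ⟩, -⟩ := hκ
  rcases (ModuleClass.categoricitySpectrum (ModuleClass.Filt C) ∩ Set.Ici κ).eq_empty_or_nonempty
    with h | h
  · refine Or.inl fun c hc => ⟨hdec ▸ hc.1, ?_⟩
    by_contra! hκc
    exact h.subset ⟨hc, hκc⟩
  -- λ is the infimum of the part of the spectrum above κ, attained because cardinals are
  -- well-ordered.
  · obtain ⟨⟨h1, h2⟩, h3⟩ := csInf_mem h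
    refine Or.inr ⟨_, h3, Set.Subset.antisymm (fun c hc => csInf_le' hc) fun c hc => ?_⟩
    refine ⟨⟨h1.trans hc, ?_⟩, le_trans (Set.mem_Ici.1 h3) hc⟩
    have hκl := Set.mem_Ici.1 h3
    have hνl := hνκ.trans hκl
    exact h2.mono hc (hR.trans hνl) (fun X hX => ((hC X hX).mk_le hν0 hR).trans hνl) hMD
      (hMκ.trans hκl) hM
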